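/- Let $G=(V,E)$ be a finite simple graph without isolated vertices, $n=|V|$. For $k=1,\dots,n$ let $$\lambda_k=\inf_{S}\ \sup_{x\in S}\ \frac{\sum_{\{i,j\}\in E}|x_i+x_j|}{\sum_{i\in V}\deg(i)\,|x_i|}$$ be the $k$-th min-max eigenvalue of the normalized signless $1$-Laplacian $\Delta_1^+$ of $G$, where the infimum is over all compact sets $S\subset\mathbb{R}^V\setminus\{0\}$ with $S=-S$ and $\operatorname{genus}(S)\ge k$. Here $\operatorname{genus}(S)$ is the Krasnoselskii genus, i.e. the least integer $m\ge 0$ for which there is a continuous odd map $S\to\mathbb{R}^m\setminus\{0\}$ (and $\infty$ if there is no such $m$). Let the multiplicity of the eigenvalue $1$ be the number of indices $k\in\{1,\dots,n\}$ with $\lambda_k=1$. Let $\alpha$ be the independence number of $G$, and let the edge covering number of $G$ be the least number of edges in a set of edges that together meet every vertex. Then: 1. The multiplicity of the eigenvalue $1$ of $\Delta_1^+$ is at least $\alpha$ and at most the edge covering number of $G$. 2. If $G$ is moreover connected and bipartite, then the multiplicity of the eigenvalue $1$ of $\Delta_1^+$ equals $\alpha$. -/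

import Mathlib

/-- The Krasnoselskii genus of a centrally symmetric set `S`: the smallest `n` such that there is
a continuous odd map from `S` to `ℝⁿ \ {0}`, and `⊤` if there is no such `n`.
In particular the genus of the empty set is `0`. -/
noncomputable def krasnoselskiiGenus {E : Type*} [TopologicalSpace E] [Neg E] (S : Set E) : ℕ∞ :=
  ⨅ (n : ℕ) (_ : ∃ f : E → (Fin n → ℝ),
    ContinuousOn f S ∧ (∀ x ∈ S, f (-x) = -f x) ∧ (∀ x ∈ S, f x ≠ 0)), (n : ℕ∞)

namespace SimpleGraph

variable {V : Type*}

/-- The functional `I⁺(x) = ∑_{ {i,j} ∈ E } |x i + x j|`, each edge being counted once. -/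
noncomputable def signlessVariation [Fintype V] [DecidableEq V] (G : SimpleGraph V)
    [DecidableRel G.Adj] (x : V → ℝ) : ℝ :=
  ∑ e ∈ G.edgeFinset,
    Sym2.lift ⟨fun i j => |x i + x j|, fun i j => by simp only [add_comm]⟩ e

/-- The degree-weighted `ℓ¹` norm `∑ i, deg(i) |x i|`. -/
noncomputable def degreeNorm [Fintype V] (G : SimpleGraph V) [DecidableRel G.Adj]
    (x : V → ℝ) : ℝ :=
  ∑ i, (G.degree i : ℝ) * |x i|

/-- The Rayleigh quotient of the normalized signless 1-Laplacian. -/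
noncomputable def signlessRayleigh [Fintype V] [DecidableEq V] (G : SimpleGraph V)
    [DecidableRel G.Adj] (x : V → ℝ) : ℝ :=
  G.signlessVariation x / G.degreeNorm x

/-- The `k`-th min-max eigenvalue of the normalized signless 1-Laplacian: the infimum, over all
compact centrally symmetric sets `S ⊆ ℝ^V \ {0}` of genus at least `k`, of the supremum over `S`
of the Rayleigh quotient. It is meant for `1 ≤ k ≤ |V|` and graphs without isolated vertices. -/
noncomputable def signlessEigenvalue [Fintype V] [DecidableEq V] (G : SimpleGraph V)
    [DecidableRel G.Adj] (k : ℕ) : ℝ :=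
  sInf {r : ℝ | ∃ S : Set (V → ℝ), IsCompact S ∧ (∀ x ∈ S, -x ∈ S) ∧ 0 ∉ S ∧
    (k : ℕ∞) ≤ krasnoselskiiGenus S ∧ r = sSup (G.signlessRayleigh '' S)}

/-- The multiplicity of `c` in the sequence `λ₁, …, λₙ` of min-max eigenvalues, `n = |V|`. -/
noncomputable def signlessMultiplicity [Fintype V] [DecidableEq V] (G : SimpleGraph V)
    [DecidableRel G.Adj] (c : ℝ) : ℕ :=
  {k : ℕ | 1 ≤ k ∧ k ≤ Fintype.card V ∧ G.signlessEigenvalue k = c}.ncard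

/-- A set of edges such that every vertex is an endpoint of one of them. -/
def IsEdgeCover (G : SimpleGraph V) (F : Set (Sym2 V)) : Prop :=
  F ⊆ G.edgeSet ∧ ∀ v : V, ∃ e ∈ F, v ∈ e

/-- The edge covering number: the least cardinality of an edge cover (`⊤` if there is none). -/
noncomputable def edgeCoverNum (G : SimpleGraph V) : ℕ∞ :=
  ⨅ (F : Set (Sym2 V)) (_ : G.IsEdgeCover F), F.encard

end SimpleGraph

/-!
For every `x` the Rayleigh quotient `R x` is at most `1` by the triangle inequality on each edge.
It equals `1` if `x ≠ 0` is supported on an independent set, and it is less than `1` if `x` takes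
opposite nonzero values at the ends of some edge. These facts bound the multiplicity of `1`.

* Let `I` be a maximum independent set. On a set of genus larger than `|V| - |I|` the coordinates
  outside `I` have a common zero, and `R = 1` there. Hence `λ_k = 1` for `k > |V| - α`
  (`signlessEigenvalue_eq_one`).
* Let `F` be an edge cover. The space of all `x` with `x u + x v = 0` for `uv ∈ F` has dimension at
  least `|V| - |F|`, and `R < 1` at all its nonzero points. Hence `λ_k < 1` for `k ≤ |V| - |F|`
  (`signlessEigenvalue_lt_one`).
* In a bipartite graph without isolated vertices Hall's theorem gives an edge cover with at most
  `α` edges (`IsBipartite.exists_isEdgeCover_card_le`), so that the two bounds agree.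

Both eigenvalue statements need compact symmetric sets of prescribed genus: for the first one, the
infimum over an empty family would be `0`. They are provided by the Borsuk–Ulam theorem, which is
proved here for the unit sphere of the `ℓ¹` norm. Mod 2 chains `h_0, h_1, …` made of the simplices
of the hemispheres satisfy `∂ h_{k+1} = h_k + ν h_k`, with `ν` the antipodal map. For odd functions
`s_1, …, s_k` with values in `ℤ/2` the cup product of their coboundaries is an invariant cocycle,
and by the Leibniz rule and induction on `k` its value on `h_k` is `1`
(`IsHemisphereTower.cup_eq_one`). Barycentric subdivision makes the simplices as small as desired
(`IsHemisphereTower.exists_small`). If `f` were an odd nowhere vanishing map to `ℝᵐ` on the sphere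
of dimension `m` or more, take for `s_i` the sign of `f_i`: on each small simplex some `f_i` has
constant sign, so that the product vanishes on `h_m`, a contradiction.
-/

/-! ### Mod 2 chains of finite sequences -/

/-- Ordered simplicial chains with coefficients in `ℤ/2`: a simplex is the list of its vertices.
Degenerate lists are allowed, and the empty list is kept, so the chain complex is augmented. -/
abbrev ModTwoChain (E : Type*) := List E →₀ ZMod 2

namespace ModTwoChain

variable {E : Type*}

lemma map_mem_of_supported {M : Type*} [AddCommGroup M] [Module (ZMod 2) M] {s : Set (List E)}
    {N : Submodule (ZMod 2) M} (F : ModTwoChain E →ₗ[ZMod 2] M)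
    (h : ∀ l ∈ s, F (Finsupp.single l 1) ∈ N) {c : ModTwoChain E}
    (hc : c ∈ Finsupp.supported (ZMod 2) (ZMod 2) s) : F c ∈ N := by
  rw [Finsupp.supported_eq_span_single] at hc
  have : Submodule.span (ZMod 2) ((fun i => Finsupp.single i (1 : ZMod 2)) '' s) ≤ N.comap F := by
    rw [Submodule.span_le]
    rintro _ ⟨l, hl, rfl⟩
    exact h l hl
  exact this hc

lemma eq_of_supported {M : Type*} [AddCommGroup M] [Module (ZMod 2) M] {s : Set (List E)}
    (F G : ModTwoChain E →ₗ[ZMod 2] M)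
    (h : ∀ l ∈ s, F (Finsupp.single l 1) = G (Finsupp.single l 1)) {c : ModTwoChain E}
    (hc : c ∈ Finsupp.supported (ZMod 2) (ZMod 2) s) : F c = G c := by
  have := map_mem_of_supported (N := ⊥) (F - G) (fun l hl => by simp [h l hl]) hc
  simpa [sub_eq_zero] using this

/-- The cone with apex `a`, put in front of every simplex. -/
noncomputable def cone (a : E) : ModTwoChain E →ₗ[ZMod 2] ModTwoChain E :=
  Finsupp.lmapDomain (ZMod 2) (ZMod 2) (List.cons a)

@[simp] lemma cone_single (a : E) (l : List E) (r : ZMod 2) :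
    cone a (Finsupp.single l r) = Finsupp.single (a :: l) r := by
  simp [cone]

/-- The boundary of a single simplex, the sum of the lists with one entry deleted. -/
noncomputable def simplexBoundary : List E → ModTwoChain E
  | [] => 0
  | a :: l => Finsupp.single l 1 + cone a (simplexBoundary l)

/-- The boundary operator of the augmented ordered chain complex. -/
noncomputable def boundary : ModTwoChain E →ₗ[ZMod 2] ModTwoChain E :=
  Finsupp.linearCombination (ZMod 2) simplexBoundary

@[simp] lemma boundary_single (l : List E) :
    boundary (Finsupp.single l 1) = simplexBoundary l := by
  simp [boundary]

lemma boundary_cone (a : E) (c : ModTwoChain E) :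
    boundary (cone a c) = c + cone a (boundary c) := by
  have : boundary ∘ₗ cone a = LinearMap.id + cone a ∘ₗ boundary := by
    ext1 l
    ext1
    simp [simplexBoundary]
  exact LinearMap.congr_fun this c

lemma boundary_simplexBoundary (l : List E) : boundary (simplexBoundary l) = 0 := by
  induction l with
  | nil => simp [simplexBoundary]
  | cons a l ih =>
    rw [simplexBoundary, map_add, boundary_cone, ih, boundary_single, map_zero, add_zero,
      ZModModule.add_self]

lemma boundary_boundary (c : ModTwoChain E) : boundary (boundary c) = 0 := by
  have : (boundary ∘ₗ boundary : ModTwoChain E →ₗ[ZMod 2] ModTwoChain E) = 0 := by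
    ext1 l
    ext1
    simp [boundary_simplexBoundary]
  exact LinearMap.congr_fun this c

lemma simplexBoundary_mem (l : List E) : simplexBoundary l ∈
    Finsupp.supported (ZMod 2) (ZMod 2) {t : List E | t.length + 1 = l.length ∧ t.Sublist l} := by
  induction l with
  | nil => simp [simplexBoundary]
  | cons a l ih =>
    rw [simplexBoundary]
    refine add_mem (Finsupp.single_mem_supported _ _ (by simp)) ?_
    refine map_mem_of_supported (cone a) (fun t ht => ?_) ih
    rw [cone_single]
    exact Finsupp.single_mem_supported _ _ ⟨by simp [ht.1], ht.2.cons_cons a⟩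

/-- The map on chains induced by a map of vertices. -/
noncomputable def vertexMap {F : Type*} (f : E → F) : ModTwoChain E →ₗ[ZMod 2] ModTwoChain F :=
  Finsupp.lmapDomain (ZMod 2) (ZMod 2) (List.map f)

@[simp] lemma vertexMap_single {F : Type*} (f : E → F) (l : List E) (r : ZMod 2) :
    vertexMap f (Finsupp.single l r) = Finsupp.single (l.map f) r := by
  simp [vertexMap]

lemma vertexMap_cone {F : Type*} (f : E → F) (a : E) (c : ModTwoChain E) :
    vertexMap f (cone a c) = cone (f a) (vertexMap f c) := by
  have : vertexMap f ∘ₗ cone a = cone (f a) ∘ₗ vertexMap f := by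
    ext1 l
    ext1
    simp
  exact LinearMap.congr_fun this c

lemma vertexMap_simplexBoundary {F : Type*} (f : E → F) (l : List E) :
    vertexMap f (simplexBoundary l) = simplexBoundary (l.map f) := by
  induction l with
  | nil => simp [simplexBoundary]
  | cons a l ih => simp [simplexBoundary, vertexMap_cone, ih]

lemma boundary_vertexMap {F : Type*} (f : E → F) (c : ModTwoChain E) :
    boundary (vertexMap f c) = vertexMap f (boundary c) := by
  have : boundary ∘ₗ vertexMap f = vertexMap f ∘ₗ boundary := by
    ext1 l
    ext1
    simp [vertexMap_simplexBoundary]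
  exact LinearMap.congr_fun this c

/-! ### Cup products of coboundaries of odd functions -/

/-- The cup product of the 1-cocycles `(u, v) ↦ s u + s v`, where `s` runs through a list of
functions on the vertices, evaluated at a simplex. It is `0` in the wrong degree, and the empty
product is the 0-cocycle `1`. -/
def cupSimplex : List (E → ZMod 2) → List E → ZMod 2
  | [], [_] => 1
  | s :: ss, v :: u :: l => (s v + s u) * cupSimplex ss (u :: l)
  | _, _ => 0

/-- `cupSimplex` extended linearly to chains. -/
noncomputable def cup (ss : List (E → ZMod 2)) : ModTwoChain E →ₗ[ZMod 2] ZMod 2 :=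
  Finsupp.linearCombination (ZMod 2) (cupSimplex ss)

/-- The cup product of the 0-cochain `s` with `cup ss`. -/
noncomputable def vertexCup (s : E → ZMod 2) (ss : List (E → ZMod 2)) :
    ModTwoChain E →ₗ[ZMod 2] ZMod 2 :=
  Finsupp.linearCombination (ZMod 2) (fun l => (l.head?.map s).getD 0 * cupSimplex ss l)

@[simp] lemma cup_single (ss : List (E → ZMod 2)) (l : List E) :
    cup ss (Finsupp.single l 1) = cupSimplex ss l := by
  simp [cup]

@[simp] lemma cupSimplex_nil (ss : List (E → ZMod 2)) : cupSimplex ss ([] : List E) = 0 := by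
  cases ss <;> rfl

/-- A product of coboundaries vanishes on a simplex if one of the functions takes the same value at
all its vertices. -/
lemma cupSimplex_eq_zero (ss : List (E → ZMod 2)) (l : List E)
    (h : ∃ s ∈ ss, ∀ p ∈ l, ∀ q ∈ l, s p = s q) : cupSimplex ss l = 0 := by
  induction ss generalizing l with
  | nil => simp at h
  | cons s ss ih =>
    match l with
    | [] => rfl
    | [v] => rfl
    | v :: u :: l =>
      rw [cupSimplex]
      obtain ⟨t, ht, hc⟩ := h
      rcases List.mem_cons.mp ht with rfl | ht
      · rw [hc v (by simp) u (by simp), ZModModule.add_self, zero_mul]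
      · rw [ih (u :: l) ⟨t, ht, fun p hp q hq => hc p (by simp [hp]) q (by simp [hq])⟩, mul_zero]

lemma vertexCup_cone (s : E → ZMod 2) (ss : List (E → ZMod 2)) (a : E) (c : ModTwoChain E) :
    vertexCup s ss (cone a c) = s a * cup ss (cone a c) := by
  have : vertexCup s ss ∘ₗ cone a = s a • (cup ss ∘ₗ cone a) := by
    ext1 l
    ext1
    simp [vertexCup]
  exact LinearMap.congr_fun this c

/-- The Leibniz rule for `s ∪ z` with `z` a cocycle. -/
lemma vertexCup_boundary_of_cocycle (s : E → ZMod 2) (ss : List (E → ZMod 2))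
    (hss : ∀ c, cup ss (boundary c) = 0) (c : ModTwoChain E) :
    vertexCup s ss (boundary c) = cup (s :: ss) c := by
  have : vertexCup s ss ∘ₗ boundary = cup (s :: ss) := by
    ext1 l
    ext1
    match l with
    | [] => simp [simplexBoundary]
    | [v] => simp [simplexBoundary, vertexCup, cupSimplex]
    | v :: u :: l =>
      have h := hss (Finsupp.single (v :: u :: l) 1)
      simp only [boundary_single] at h
      rw [simplexBoundary, map_add, cup_single] at h
      simp only [LinearMap.coe_comp, Function.comp_apply, Finsupp.lsingle_apply, boundary_single,
        cup_single]
      rw [simplexBoundary, map_add, vertexCup_cone]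
      have h' : cup ss (cone v (simplexBoundary (u :: l))) = cupSimplex ss (u :: l) := by
        rw [← sub_eq_zero, sub_eq_add_neg, ZModModule.neg_eq_self, add_comm]
        exact h
      rw [h']
      simp [vertexCup, cupSimplex]
      ring
  exact LinearMap.congr_fun this c

lemma cup_boundary (ss : List (E → ZMod 2)) (c : ModTwoChain E) : cup ss (boundary c) = 0 := by
  induction ss generalizing c with
  | nil =>
    have : cup ([] : List (E → ZMod 2)) ∘ₗ boundary = 0 := by
      ext1 l
      ext1
      match l with
      | [] => simp [simplexBoundary]
      | [v] => simp [simplexBoundary]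
      | [v, u] =>
        simp [simplexBoundary, cupSimplex]
        decide
      | v :: u :: w :: l =>
        have h0 : ∀ c : ModTwoChain E, cup [] (cone v (cone u c)) = 0 := by
          intro c
          have : cup [] ∘ₗ cone v ∘ₗ cone u = 0 := by
            ext1 l
            ext1
            simp [cupSimplex]
          exact LinearMap.congr_fun this c
        simp only [LinearMap.coe_comp, Function.comp_apply, Finsupp.lsingle_apply,
          boundary_single, simplexBoundary, map_add, h0]
        simp [cupSimplex]
    exact LinearMap.congr_fun this c
  | cons s ss ih =>
    rw [← vertexCup_boundary_of_cocycle s ss ih, boundary_boundary, map_zero]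

lemma vertexCup_boundary (s : E → ZMod 2) (ss : List (E → ZMod 2)) (c : ModTwoChain E) :
    vertexCup s ss (boundary c) = cup (s :: ss) c :=
  vertexCup_boundary_of_cocycle s ss (cup_boundary ss) c

variable [AddCommGroup E]

/-- The cocycle `(u, v) ↦ s u + s v` is antipode-invariant for odd `s`. -/
lemma cupSimplex_map_neg (ss : List (E → ZMod 2)) (l : List E)
    (h : ∀ s ∈ ss, ∀ v ∈ l, s (-v) = s v + 1) :
    cupSimplex ss (l.map Neg.neg) = cupSimplex ss l := by
  induction ss generalizing l with
  | nil =>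
    match l with
    | [] => rfl
    | [v] => rfl
    | v :: u :: l => rfl
  | cons s ss ih =>
    match l with
    | [] => rfl
    | [v] => rfl
    | v :: u :: l =>
      have h1 := h s (by simp) v (by simp)
      have h2 := h s (by simp) u (by simp)
      have h3 := ih (u :: l) (fun s hs v hv => h s (by simp [hs]) v (by simp [hv]))
      simp only [List.map_cons] at h3 ⊢
      rw [cupSimplex, cupSimplex, h3, h1, h2]
      have : (1 : ZMod 2) + 1 = 0 := by decide
      linear_combination (cupSimplex ss (u :: l)) * this

/-- Chains `h 0, h 1, …, h m` playing the role of hemispheres of spheres of increasing dimension: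
`h 0` is a point, and the boundary of `h (k + 1)` is the sphere formed by `h k` and its
antipode. Every simplex that occurs has its convex hull in `S` and diameter at most `D`. -/
structure IsHemisphereTower [Module ℝ E] [Dist E] (m : ℕ) (S : Set E) (D : ℝ)
    (h : ℕ → ModTwoChain E) : Prop where
  mem : ∀ k ≤ m, h k ∈ Finsupp.supported (ZMod 2) (ZMod 2)
    {l : List E | l.length = k + 1 ∧ convexHull ℝ {v | v ∈ l} ⊆ S ∧
      ∀ p ∈ l, ∀ q ∈ l, dist p q ≤ D}
  zero : ∃ p : E, h 0 = Finsupp.single [p] 1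
  boundary_succ : ∀ k < m, boundary (h (k + 1)) = h k + vertexMap Neg.neg (h k)

/-- The cup product of the coboundaries of `k` odd functions is `1` on the `k`-th hemisphere. -/
lemma IsHemisphereTower.cup_eq_one [Module ℝ E] [Dist E] {m : ℕ} {S : Set E} {D : ℝ}
    {h : ℕ → ModTwoChain E} (hh : IsHemisphereTower m S D h) (ss : List (E → ZMod 2))
    (hm : ss.length ≤ m) (hodd : ∀ s ∈ ss, ∀ v ∈ S, s (-v) = s v + 1) :
    cup ss (h ss.length) = 1 := by
  induction ss with
  | nil =>
    obtain ⟨p, hp⟩ := hh.zero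
    simp [hp, cupSimplex]
  | cons s ss ih =>
    have hm' : ss.length < m := by simpa using hm
    rw [← vertexCup_boundary, List.length_cons, hh.boundary_succ _ hm',
      ← ih hm'.le (fun s hs => hodd s (by simp [hs]))]
    refine eq_of_supported (vertexCup s ss ∘ₗ (LinearMap.id + vertexMap Neg.neg)) (cup ss) ?_
      (hh.mem _ hm'.le)
    rintro l ⟨hl, hS, -⟩
    have hlS : ∀ v ∈ l, v ∈ S := fun v hv => hS (subset_convexHull ℝ _ hv)
    match l with
    | [] => simp at hl
    | v :: l =>
      have h1 := cupSimplex_map_neg ss (v :: l)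
        (fun s hs v hv => hodd s (by simp [hs]) v (hlS v hv))
      have h2 := hodd s (by simp) v (hlS v (by simp))
      rw [List.map_cons] at h1
      simp only [vertexCup, LinearMap.coe_comp, Function.comp_apply, LinearMap.add_apply,
        LinearMap.id_apply, map_add, vertexMap_single, List.map_cons,
        Finsupp.linearCombination_single, cup_single, h1]
      have h3 : (1 : ZMod 2) + 1 = 0 := by decide
      simp [h2]
      linear_combination (cupSimplex ss (v :: l)) * (s v) * h3

end ModTwoChain

/-! ### Barycentric subdivision -/

namespace ModTwoChain

section Subdivision

variable {E : Type*} [NormedAddCommGroup E] [NormedSpace ℝ E]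

/-- The mean of the entries of a list (`0` for the empty list). -/
noncomputable def barycenter (l : List E) : E := (l.length : ℝ)⁻¹ • l.sum

lemma barycenter_eq_sum (l : List E) :
    barycenter l = ∑ i : Fin l.length, (l.length : ℝ)⁻¹ • l.get i := by
  rw [barycenter, ← Finset.smul_sum]
  congr 1
  conv_lhs => rw [← List.ofFn_get l]
  rw [List.sum_ofFn]

lemma barycenter_mem_convexHull {l : List E} (hl : l ≠ []) :
    barycenter l ∈ convexHull ℝ {v | v ∈ l} := by
  have h0 : (l.length : ℝ) ≠ 0 := by simpa using hl
  rw [barycenter_eq_sum]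
  refine (convex_convexHull ℝ _).sum_mem (fun i _ => by positivity) ?_
    (fun i _ => subset_convexHull ℝ _ (List.get_mem l i))
  simp [h0]

/-- Of the `n + 1` differences between the entries of `l` and a given one, one vanishes; this is
why the barycenter is closer to `v` than the diameter. -/
lemma dist_barycenter_le {l : List E} {n : ℕ} (hn : l.length = n + 1) {D : ℝ}
    (hD : ∀ p ∈ l, ∀ q ∈ l, dist p q ≤ D) {v : E} (hv : v ∈ l) :
    dist v (barycenter l) ≤ (n : ℝ) / (n + 1) * D := by
  obtain ⟨j, rfl⟩ := List.get_of_mem hv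
  have h0 : (l.length : ℝ) ≠ 0 := by simp [hn]; positivity
  have h1 : barycenter l - l.get j
      = (l.length : ℝ)⁻¹ • ∑ i ∈ Finset.univ.erase j, (l.get i - l.get j) := by
    rw [Finset.sum_erase _ (by simp), Finset.sum_sub_distrib, smul_sub,
      barycenter_eq_sum, Finset.smul_sum]
    simp only [Finset.sum_const, Finset.card_univ, Fintype.card_fin]
    rw [← Nat.cast_smul_eq_nsmul ℝ, smul_smul, inv_mul_cancel₀ h0, one_smul]
  rw [dist_comm, dist_eq_norm, h1, norm_smul]
  have h2 : ‖∑ i ∈ Finset.univ.erase j, (l.get i - l.get j)‖ ≤ n * D := by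
    refine (norm_sum_le_of_le (n := fun _ => D) _ (fun i _ => ?_)).trans_eq ?_
    · rw [← dist_eq_norm]
      exact hD _ (List.get_mem l i) _ (List.get_mem l j)
    · simp [Finset.card_erase_of_mem, hn]
  have h3 : ‖(l.length : ℝ)⁻¹‖ = ((n : ℝ) + 1)⁻¹ := by
    rw [norm_inv, Real.norm_natCast, hn, Nat.cast_add_one]
  rw [h3]
  calc ((n : ℝ) + 1)⁻¹ * _ ≤ ((n : ℝ) + 1)⁻¹ * (n * D) := by gcongr
    _ = _ := by ring

/-- Barycentric subdivision of simplices with `n` vertices: the subdivided boundary is coned off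
from the barycenter. -/
noncomputable def subdivide : ℕ → ModTwoChain E →ₗ[ZMod 2] ModTwoChain E
  | 0 => LinearMap.id
  | n + 1 => Finsupp.linearCombination (ZMod 2)
      (fun l => cone (barycenter l) (subdivide n (simplexBoundary l)))

lemma subdivide_succ_single (n : ℕ) (l : List E) :
    subdivide (n + 1) (Finsupp.single l 1)
      = cone (barycenter l) (subdivide n (simplexBoundary l)) := by
  simp [subdivide]

lemma boundary_subdivide (n : ℕ) (c : ModTwoChain E) :
    boundary (subdivide (n + 1) c) = subdivide n (boundary c) := by
  induction n generalizing c with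
  | zero =>
    have : boundary ∘ₗ subdivide 1 = subdivide 0 ∘ₗ (boundary : ModTwoChain E →ₗ[ZMod 2] _) := by
      ext1 l
      ext1
      simp [boundary_cone, subdivide, boundary_simplexBoundary]
    exact LinearMap.congr_fun this c
  | succ n ih =>
    have : boundary ∘ₗ subdivide (n + 2)
        = subdivide (n + 1) ∘ₗ (boundary : ModTwoChain E →ₗ[ZMod 2] _) := by
      ext1 l
      ext1
      simp [subdivide_succ_single, boundary_cone, ih, boundary_simplexBoundary]
    exact LinearMap.congr_fun this c

lemma barycenter_map_neg (l : List E) : barycenter (l.map Neg.neg) = -barycenter l := by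
  have : ∀ l : List E, (l.map Neg.neg).sum = -l.sum := by
    intro l
    induction l with
    | nil => simp
    | cons a l ih => simp only [List.map_cons, List.sum_cons, ih]; abel
  simp [barycenter, this]

lemma subdivide_vertexMap_neg (n : ℕ) (c : ModTwoChain E) :
    subdivide n (vertexMap Neg.neg c) = vertexMap Neg.neg (subdivide n c) := by
  induction n generalizing c with
  | zero => rfl
  | succ n ih =>
    have : subdivide (n + 1) ∘ₗ vertexMap Neg.neg
        = vertexMap Neg.neg ∘ₗ (subdivide (n + 1) : ModTwoChain E →ₗ[ZMod 2] _) := by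
      ext1 l
      ext1
      simp [subdivide_succ_single, barycenter_map_neg, vertexMap_cone, ← ih,
        vertexMap_simplexBoundary]
    exact LinearMap.congr_fun this c

lemma subdivide_single_mem {M : ℕ} {D : ℝ} (n : ℕ) (hn : n ≤ M) (l : List E)
    (hl : l.length = n) (hD : ∀ p ∈ l, ∀ q ∈ l, dist p q ≤ D) :
    subdivide n (Finsupp.single l 1) ∈ Finsupp.supported (ZMod 2) (ZMod 2)
      {t : List E | t.length = n ∧ (∀ p ∈ t, p ∈ convexHull ℝ {v | v ∈ l}) ∧
        ∀ p ∈ t, ∀ q ∈ t, dist p q ≤ (1 - (M : ℝ)⁻¹) * D} := by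
  induction n generalizing l with
  | zero =>
    obtain rfl : l = [] := List.length_eq_zero_iff.mp hl
    exact Finsupp.single_mem_supported _ _ (by simp)
  | succ n ih =>
    have hne : l ≠ [] := by rintro rfl; simp at hl
    have hD0 : 0 ≤ D := by
      obtain ⟨v, hv⟩ := List.exists_mem_of_ne_nil l hne
      simpa using hD v hv v hv
    have hb := barycenter_mem_convexHull hne
    have hr : (n : ℝ) / (n + 1) * D ≤ (1 - (M : ℝ)⁻¹) * D := by
      gcongr
      have : (M : ℝ)⁻¹ ≤ ((n : ℝ) + 1)⁻¹ := by
        gcongr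
        exact_mod_cast hn
      have h2 : (n : ℝ) / (n + 1) = 1 - ((n : ℝ) + 1)⁻¹ := by
        field_simp
        ring
      linarith
    have hball : ∀ p ∈ convexHull ℝ {v | v ∈ l},
        dist p (barycenter l) ≤ (1 - (M : ℝ)⁻¹) * D := by
      intro p hp
      have : convexHull ℝ {v | v ∈ l} ⊆ Metric.closedBall (barycenter l) (n / (n + 1) * D) :=
        convexHull_min (fun v hv => dist_barycenter_le hl hD hv) (convex_closedBall _ _)
      exact (Metric.mem_closedBall.mp (this hp)).trans hr
    rw [subdivide_succ_single]
    refine map_mem_of_supported (cone (barycenter l) ∘ₗ subdivide n) (fun l' hl' => ?_)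
      (simplexBoundary_mem l)
    obtain ⟨hlen, hsub⟩ := hl'
    have hsubset : ∀ v ∈ l', v ∈ l := fun v hv => hsub.subset hv
    refine map_mem_of_supported (cone (barycenter l)) (fun t ht => ?_)
      (ih (by omega) l' (by omega)
        (fun p hp q hq => hD p (hsubset p hp) q (hsubset q hq)))
    obtain ⟨h1, h2, h3⟩ := ht
    have h2' : ∀ p ∈ t, p ∈ convexHull ℝ {v | v ∈ l} := fun p hp =>
      convexHull_mono hsubset (h2 p hp)
    rw [cone_single]
    refine Finsupp.single_mem_supported _ _ ⟨by simp [h1], ?_, ?_⟩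
    · simpa [hb] using h2'
    · intro p hp q hq
      rcases List.mem_cons.mp hp with rfl | hp <;> rcases List.mem_cons.mp hq with rfl | hq
      · simpa using (dist_nonneg.trans (hball _ hb))
      · rw [dist_comm]
        exact hball q (h2' q hq)
      · exact hball p (h2' p hp)
      · exact h3 p hp q hq

lemma IsHemisphereTower.subdivide {m : ℕ} {S : Set E} {D : ℝ} {h : ℕ → ModTwoChain E}
    (hh : IsHemisphereTower m S D h) :
    IsHemisphereTower m S ((1 - ((m + 1 : ℕ) : ℝ)⁻¹) * D)
      (fun k => ModTwoChain.subdivide (k + 1) (h k)) where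
  mem k hk := by
    refine map_mem_of_supported (ModTwoChain.subdivide (k + 1)) (fun l hl => ?_) (hh.mem k hk)
    obtain ⟨h1, h2, h3⟩ := hl
    refine Finsupp.supported_mono ?_
      (subdivide_single_mem (M := m + 1) (k + 1) (by omega) l h1 h3)
    rintro t ⟨ht1, ht2, ht3⟩
    exact ⟨ht1, (convexHull_min ht2 (convex_convexHull ℝ _)).trans h2, ht3⟩
  zero := by
    obtain ⟨p, hp⟩ := hh.zero
    refine ⟨p, ?_⟩
    simp [hp, simplexBoundary, barycenter, ModTwoChain.subdivide]
  boundary_succ k hk := by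
    rw [boundary_subdivide, hh.boundary_succ k hk, map_add, subdivide_vertexMap_neg]

lemma IsHemisphereTower.exists_small {m : ℕ} {S : Set E} {D : ℝ} {h : ℕ → ModTwoChain E}
    (hh : IsHemisphereTower m S D h) {δ : ℝ} (hδ : 0 < δ) :
    ∃ h', IsHemisphereTower m S δ h' := by
  set r : ℝ := 1 - ((m + 1 : ℕ) : ℝ)⁻¹ with hr
  have hpos : 0 < ((m + 1 : ℕ) : ℝ)⁻¹ := by positivity
  have hle : ((m + 1 : ℕ) : ℝ)⁻¹ ≤ 1 := by
    apply inv_le_one_of_one_le₀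
    simp
  have hiter : ∀ N : ℕ, ∃ h', IsHemisphereTower m S (r ^ N * D) h' := by
    intro N
    induction N with
    | zero => exact ⟨h, by simpa using hh⟩
    | succ N ih =>
      obtain ⟨h', hh'⟩ := ih
      have := hh'.subdivide
      rw [← mul_assoc, ← hr, ← pow_succ'] at this
      exact ⟨_, this⟩
  have hlim : Filter.Tendsto (fun N : ℕ => r ^ N * D) Filter.atTop (nhds 0) := by
    simpa using (tendsto_pow_atTop_nhds_zero_of_lt_one (by linarith : 0 ≤ r)
      (by linarith)).mul_const D
  obtain ⟨N, hN⟩ := (hlim.eventually_lt_const hδ).exists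
  obtain ⟨h', hh'⟩ := hiter N
  refine ⟨h', fun k hk => Finsupp.supported_mono ?_ (hh'.mem k hk), hh'.zero, hh'.boundary_succ⟩
  rintro t ⟨h1, h2, h3⟩
  exact ⟨h1, h2, fun p hp q hq => (h3 p hp q hq).trans hN.le⟩

end Subdivision

end ModTwoChain

/-! ### The octahedral sphere -/

section BorsukUlam

open ModTwoChain

/-- The unit sphere of the `ℓ¹` norm in `ℝᵈ`. -/
def octahedralSphere (d : ℕ) : Set (Fin d → ℝ) := {x | ∑ i, |x i| = 1}

/-- The closed facet of the octahedral sphere in the orthant with signs `ε`. -/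
def octahedralFacet {d : ℕ} (ε : Fin d → ℝ) : Set (Fin d → ℝ) :=
  {x | (∀ i, 0 ≤ ε i * x i) ∧ ∑ i, ε i * x i = 1}

lemma convex_octahedralFacet {d : ℕ} (ε : Fin d → ℝ) : Convex ℝ (octahedralFacet ε) := by
  rintro x ⟨hx, hx1⟩ y ⟨hy, hy1⟩ a b ha hb hab
  refine ⟨fun i => ?_, ?_⟩
  · have := mul_nonneg ha (hx i)
    have := mul_nonneg hb (hy i)
    simp only [Pi.add_apply, Pi.smul_apply, smul_eq_mul]
    linarith
  · have : ∀ i, ε i * (a • x + b • y) i = a * (ε i * x i) + b * (ε i * y i) := fun i => by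
      simp only [Pi.add_apply, Pi.smul_apply, smul_eq_mul]
      ring
    simp_rw [this]
    rw [Finset.sum_add_distrib, ← Finset.mul_sum, ← Finset.mul_sum, hx1, hy1]
    linarith

lemma octahedralFacet_subset {d : ℕ} {ε : Fin d → ℝ} (hε : ∀ i, |ε i| = 1) :
    octahedralFacet ε ⊆ octahedralSphere d := by
  rintro x ⟨hx, hx1⟩
  have : ∀ i, |x i| = ε i * x i := fun i => by
    rw [← abs_of_nonneg (hx i), abs_mul, hε, one_mul]
  simp only [octahedralSphere, Set.mem_ofPred_eq, this, hx1]

/-- The standard basis vectors of `ℝᵈ`, indexed by `ℕ` and `0` from index `d` on. -/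
def basisVector (d k : ℕ) : Fin d → ℝ := fun i => if (i : ℕ) = k then 1 else 0

/-- The `k`-th hemisphere of the octahedral sphere, the sum of all simplices
`e_k, ±e_{k-1}, …, ±e_0`, where the last vertex is `e_0` if `k = 0`. -/
noncomputable def octahedralHemisphere (d : ℕ) : ℕ → ModTwoChain (Fin d → ℝ)
  | 0 => Finsupp.single [basisVector d 0] 1
  | k + 1 => cone (basisVector d (k + 1))
      (octahedralHemisphere d k + vertexMap Neg.neg (octahedralHemisphere d k))

lemma boundary_octahedralHemisphere (d k : ℕ) :
    boundary (octahedralHemisphere d (k + 1))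
      = octahedralHemisphere d k + vertexMap Neg.neg (octahedralHemisphere d k) := by
  have hinv : ∀ c : ModTwoChain (Fin d → ℝ), vertexMap Neg.neg (vertexMap Neg.neg c) = c := by
    intro c
    have : vertexMap Neg.neg ∘ₗ vertexMap Neg.neg
        = (LinearMap.id : ModTwoChain (Fin d → ℝ) →ₗ[ZMod 2] _) := by
      ext1 l
      ext1
      simp
    exact LinearMap.congr_fun this c
  have key : boundary
      (octahedralHemisphere d k + vertexMap Neg.neg (octahedralHemisphere d k)) = 0 := by
    induction k with
    | zero =>
      simp [octahedralHemisphere, simplexBoundary]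
      exact ZModModule.add_self _
    | succ k ih =>
      rw [map_add, boundary_vertexMap, octahedralHemisphere, boundary_cone, ih, map_zero, add_zero,
        map_add, hinv, add_comm (vertexMap _ _), ZModModule.add_self]
  rw [octahedralHemisphere, boundary_cone, key, map_zero, add_zero]

lemma octahedralHemisphere_mem {d : ℕ} (k : ℕ) (hk : k < d) :
    octahedralHemisphere d k ∈ Finsupp.supported (ZMod 2) (ZMod 2)
      {l : List (Fin d → ℝ) | l.length = k + 1 ∧
        (∀ v ∈ l, ∀ i : Fin d, k < i → v i = 0) ∧
        ∃ ε : Fin d → ℝ, (∀ i, |ε i| = 1) ∧ ∀ v ∈ l, v ∈ octahedralFacet ε} := by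
  have hbasis : ∀ k (hk : k < d) (ε : Fin d → ℝ), ε ⟨k, hk⟩ = 1 →
      basisVector d k ∈ octahedralFacet ε := by
    intro k hk ε hε
    have h1 : ∀ i : Fin d, ε i * basisVector d k i = if i = ⟨k, hk⟩ then 1 else 0 := by
      intro i
      by_cases h : i = ⟨k, hk⟩
      · subst h; simp [basisVector, hε]
      · have : (i : ℕ) ≠ k := fun h' => h (Fin.ext h')
        simp [basisVector, h, this]
    refine ⟨fun i => ?_, ?_⟩
    · rw [h1]; split_ifs <;> norm_num
    · simp [h1]
  induction k with
  | zero =>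
    refine Finsupp.single_mem_supported _ _ ⟨rfl, ?_, fun _ => 1, by simp, ?_⟩
    · intro v hv i hi
      obtain rfl : v = basisVector d 0 := by simpa using hv
      simp [basisVector, hi.ne']
    · intro v hv
      obtain rfl : v = basisVector d 0 := by simpa using hv
      exact hbasis 0 hk _ rfl
  | succ k ih =>
    have ih := ih (by omega)
    rw [octahedralHemisphere]
    refine map_mem_of_supported (cone _) (s := {l : List (Fin d → ℝ) | l.length = k + 1 ∧
        (∀ v ∈ l, ∀ i : Fin d, k < i → v i = 0) ∧
        ∃ ε : Fin d → ℝ, (∀ i, |ε i| = 1) ∧ ∀ v ∈ l, v ∈ octahedralFacet ε}) ?_ ?_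
    · rintro l ⟨hl, hl0, ε, hε, hlε⟩
      rw [cone_single]
      refine Finsupp.single_mem_supported _ _ ⟨by simp [hl], ?_,
        Function.update ε ⟨k + 1, hk⟩ 1, ?_, ?_⟩
      · intro v hv i hi
        rcases List.mem_cons.mp hv with rfl | hv
        · simp [basisVector, hi.ne']
        · exact hl0 v hv i (by omega)
      · intro i
        by_cases h : i = ⟨k + 1, hk⟩
        · subst h; simp
        · simp [h, hε]
      · intro v hv
        rcases List.mem_cons.mp hv with rfl | hv
        · exact hbasis _ hk _ (by simp)
        · -- the sign at `k + 1` is free since `v` vanishes there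
          have h1 : ∀ i, Function.update ε ⟨k + 1, hk⟩ 1 i * v i = ε i * v i := by
            intro i
            by_cases h : i = ⟨k + 1, hk⟩
            · subst h
              simp [hl0 v hv ⟨k + 1, hk⟩ (by simp)]
            · simp [h]
          simpa only [octahedralFacet, Set.mem_ofPred_eq, h1] using hlε v hv
    · refine add_mem ih ?_
      refine map_mem_of_supported (vertexMap Neg.neg) ?_ ih
      rintro l ⟨hl, hl0, ε, hε, hlε⟩
      rw [vertexMap_single]
      refine Finsupp.single_mem_supported _ _ ⟨by simp [hl], ?_, -ε, by simpa using hε, ?_⟩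
      · intro v hv i hi
        obtain ⟨w, hw, rfl⟩ := List.mem_map.mp hv
        simp [hl0 w hw i hi]
      · intro v hv
        obtain ⟨w, hw, rfl⟩ := List.mem_map.mp hv
        simpa [octahedralFacet] using hlε w hw

lemma isHemisphereTower_octahedral {d m : ℕ} (hm : m < d) :
    IsHemisphereTower m (octahedralSphere d) 2 (octahedralHemisphere d) where
  mem k hk := by
    refine Finsupp.supported_mono ?_ (octahedralHemisphere_mem k (by omega))
    rintro l ⟨h1, -, ε, hε, hl⟩
    refine ⟨h1, (convexHull_min hl (convex_octahedralFacet ε)).trans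
      (octahedralFacet_subset hε), ?_⟩
    have hnorm : ∀ v ∈ l, ‖v‖ ≤ 1 := by
      intro v hv
      have hv' : ∑ i, |v i| = 1 := octahedralFacet_subset hε (hl v hv)
      refine (pi_norm_le_iff_of_nonneg zero_le_one).mpr fun i => ?_
      rw [Real.norm_eq_abs, ← hv']
      exact Finset.single_le_sum (f := fun i => |v i|) (fun i _ => abs_nonneg _)
        (Finset.mem_univ i)
    intro p hp q hq
    rw [dist_eq_norm]
    linarith [norm_sub_le p q, hnorm p hp, hnorm q hq]
  zero := ⟨_, rfl⟩
  boundary_succ k _ := boundary_octahedralHemisphere d k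

/-! ### The Borsuk–Ulam theorem -/

lemma isCompact_octahedralSphere (d : ℕ) : IsCompact (octahedralSphere d) := by
  refine Metric.isCompact_of_isClosed_isBounded ?_ ?_
  · exact isClosed_eq (by fun_prop) continuous_const
  · refine (Metric.isBounded_closedBall (x := (0 : Fin d → ℝ)) (r := 1)).subset fun v hv => ?_
    rw [mem_closedBall_zero_iff]
    refine (pi_norm_le_iff_of_nonneg zero_le_one).mpr fun i => ?_
    rw [Real.norm_eq_abs, ← (show ∑ i, |v i| = 1 from hv)]
    exact Finset.single_le_sum (f := fun i => |v i|) (fun i _ => abs_nonneg _)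
      (Finset.mem_univ i)

lemma zero_notMem_octahedralSphere (d : ℕ) : (0 : Fin d → ℝ) ∉ octahedralSphere d := by
  simp [octahedralSphere]

lemma neg_mem_octahedralSphere {d : ℕ} {x : Fin d → ℝ} (hx : x ∈ octahedralSphere d) :
    -x ∈ octahedralSphere d := by
  simpa [octahedralSphere] using hx

/-- An odd function on the nonzero vectors: the sign of the first nonzero coordinate. -/
lemma exists_odd_sign (d : ℕ) :
    ∃ g : (Fin d → ℝ) → ZMod 2, ∀ x, x ≠ 0 → g (-x) = g x + 1 := by
  classical
  refine ⟨fun x => if ∃ i, 0 < x i ∧ ∀ j < i, x j = 0 then 1 else 0, fun x hx => ?_⟩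
  obtain ⟨i, hi, hmin⟩ : ∃ i, x i ≠ 0 ∧ ∀ j < i, x j = 0 := by
    obtain ⟨i, hi, hmin⟩ := WellFounded.has_min (wellFounded_lt (α := Fin d)) {i | x i ≠ 0}
      (Function.ne_iff.mp hx)
    exact ⟨i, hi, fun j hj => by_contra fun h => hmin j h hj⟩
  have key : ∀ y : Fin d → ℝ, y i ≠ 0 → (∀ j < i, y j = 0) →
      ((∃ i, 0 < y i ∧ ∀ j < i, y j = 0) ↔ 0 < y i) := by
    refine fun y hy hy0 => ⟨fun ⟨k, hk, hk0⟩ => ?_, fun h => ⟨i, h, hy0⟩⟩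
    rcases lt_trichotomy k i with h | rfl | h
    · exact absurd (hy0 k h) hk.ne'
    · exact hk
    · exact absurd (hk0 i h) hy
  simp only [key x hi hmin, key (-x) (by simpa using hi) (fun j hj => by simp [hmin j hj])]
  rcases lt_or_gt_of_ne hi with h | h
  · simp [h, h.not_gt]
  · have h2 : (0 : ZMod 2) = 1 + 1 := by decide
    simp [h, h.not_gt, ← h2]

/-- The Borsuk–Ulam theorem on the octahedral sphere: the coboundaries of the signs of the
coordinates of `f` have cup product `1` on the top hemisphere, but on a simplex so small that some
coordinate of `f` does not change its sign there, the product vanishes. -/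
theorem exists_eq_zero_of_odd_on_octahedralSphere {d m : ℕ} (hm : m < d) (f : (Fin d → ℝ) → (Fin m → ℝ))
    (hf : ContinuousOn f (octahedralSphere d))
    (hodd : ∀ x ∈ octahedralSphere d, f (-x) = -f x) : ∃ x ∈ octahedralSphere d, f x = 0 := by
  classical
  by_contra! hne
  have hS := isCompact_octahedralSphere d
  -- `c` is a lower bound for the sup norm of `f`
  obtain ⟨c, hc, hcf⟩ : ∃ c > 0, ∀ x ∈ octahedralSphere d, c ≤ ‖f x‖ := by
    rcases (octahedralSphere d).eq_empty_or_nonempty with he | hn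
    · exact ⟨1, one_pos, by simp [he]⟩
    · obtain ⟨x, hx, hmin⟩ := hS.exists_isMinOn hn hf.norm
      exact ⟨‖f x‖, norm_pos_iff.mpr (hne x hx), fun y hy => hmin hy⟩
  obtain ⟨δ, hδ, hfδ⟩ := Metric.uniformContinuousOn_iff_le.mp
    (hS.uniformContinuousOn_of_continuous hf) (c / 2) (by positivity)
  obtain ⟨h, hh⟩ := (isHemisphereTower_octahedral hm).exists_small hδ
  obtain ⟨g, hg⟩ := exists_odd_sign d
  let s : Fin m → (Fin d → ℝ) → ZMod 2 := fun i x =>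
    if 0 < f x i then 1 else if f x i < 0 then 0 else g x
  have hs : ∀ i, ∀ x ∈ octahedralSphere d, s i (-x) = s i x + 1 := by
    intro i x hx
    have h2 : (0 : ZMod 2) = 1 + 1 := by decide
    simp only [s, hodd x hx, Pi.neg_apply, Left.neg_pos_iff, Left.neg_neg_iff]
    rcases lt_trichotomy (f x i) 0 with h | h | h
    · simp [h, h.not_gt]
    · have hx0 : x ≠ 0 := fun h0 => zero_notMem_octahedralSphere d (h0 ▸ hx)
      simp [h, hg x hx0]
    · simp [h, h.not_gt, ← h2]
  have h1 := hh.cup_eq_one (List.ofFn s) (by simp) (by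
    intro t ht
    obtain ⟨i, rfl⟩ := List.mem_ofFn.mp ht
    exact hs i)
  rw [List.length_ofFn] at h1
  have h0 : cup (List.ofFn s) (h m) = 0 := by
    refine eq_of_supported (cup (List.ofFn s)) 0 ?_ (hh.mem m le_rfl)
    rintro l ⟨hl, hlS, hlδ⟩
    have hlS' : ∀ v ∈ l, v ∈ octahedralSphere d := fun v hv => hlS (subset_convexHull ℝ _ hv)
    rw [cup_single, LinearMap.zero_apply]
    apply cupSimplex_eq_zero
    obtain ⟨v, hv⟩ : ∃ v, v ∈ l := List.exists_mem_of_ne_nil l (by rintro rfl; simp at hl)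
    -- a coordinate that realizes the norm of `f v` keeps its sign on the whole simplex
    obtain ⟨i, hi⟩ : ∃ i, c / 2 < |f v i| := by
      by_contra! hcon
      have := (pi_norm_le_iff_of_nonneg (x := f v) (half_pos hc).le).mpr hcon
      linarith [hcf v (hlS' v hv)]
    refine ⟨s i, List.mem_ofFn.mpr ⟨i, rfl⟩, ?_⟩
    have hconst : ∀ p ∈ l, s i p = s i v := by
      intro p hp
      have hd : |f p i - f v i| ≤ c / 2 := by
        have := (dist_le_pi_dist (f p) (f v) i).trans
          (hfδ p (hlS' p hp) v (hlS' v hv) (hlδ p hp v hv))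
        rwa [Real.dist_eq] at this
      rw [abs_le] at hd
      rcases lt_abs.mp hi with h | h
      · have ha : 0 < f p i := by linarith
        have hb : 0 < f v i := by linarith
        simp [s, ha, hb]
      · have ha : f p i < 0 := by linarith
        have hb : f v i < 0 := by linarith
        simp [s, ha, hb, ha.not_gt, hb.not_gt]
    intro p hp q hq
    rw [hconst p hp, hconst q hq]
  rw [h0] at h1
  exact absurd h1 (by decide)

end BorsukUlam

/-! ### Spheres of prescribed genus -/

/-- The image of the octahedral sphere under a linear isomorphism `ℝᵈ → W` has genus at least `d`,
by the Borsuk–Ulam theorem. -/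
lemma exists_compact_symmetric_subset_of_submodule {E : Type*} [NormedAddCommGroup E]
    [NormedSpace ℝ E] (W : Submodule ℝ E) [FiniteDimensional ℝ W] :
    ∃ S : Set E, IsCompact S ∧ (∀ x ∈ S, -x ∈ S) ∧ 0 ∉ S ∧ S ⊆ W ∧
      (Module.finrank ℝ W : ℕ∞) ≤ krasnoselskiiGenus S := by
  set d := Module.finrank ℝ W with hd
  let e : (Fin d → ℝ) ≃ₗ[ℝ] W := LinearEquiv.ofFinrankEq _ _ (by simp [hd])
  let L : (Fin d → ℝ) →ₗ[ℝ] E := W.subtype ∘ₗ e.toLinearMap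
  have hL : Continuous L := L.continuous_of_finiteDimensional
  refine ⟨L '' octahedralSphere d, (isCompact_octahedralSphere d).image hL, ?_, ?_, ?_, ?_⟩
  · rintro _ ⟨x, hx, rfl⟩
    exact ⟨-x, neg_mem_octahedralSphere hx, map_neg L x⟩
  · rintro ⟨x, hx, h0⟩
    have : x = 0 := by simpa [L] using h0
    exact zero_notMem_octahedralSphere d (this ▸ hx)
  · rintro _ ⟨x, hx, rfl⟩
    exact (e x).2
  · refine le_iInf₂ fun m ⟨f, hf, hodd, hne⟩ => ?_
    by_contra hlt
    obtain ⟨x, hx, hx0⟩ := exists_eq_zero_of_odd_on_octahedralSphere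
      (by exact_mod_cast not_le.mp hlt) (f ∘ L)
      (hf.comp hL.continuousOn (Set.mapsTo_image _ _))
      (fun x hx => by simpa using hodd _ (Set.mem_image_of_mem L hx))
    exact hne _ (Set.mem_image_of_mem L hx) hx0

/-- On a set of genus larger than `|T|` the coordinates in `T` have a common zero. -/
lemma exists_forall_eq_zero_of_card_lt_genus {V : Type*} {S : Set (V → ℝ)} (T : Finset V)
    (hS : (T.card : ℕ∞) < krasnoselskiiGenus S) : ∃ x ∈ S, ∀ v ∈ T, x v = 0 := by
  by_contra! hcon
  refine hS.not_ge (iInf₂_le T.card ⟨fun x i => x (T.equivFin.symm i), ?_, ?_, ?_⟩)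
  · exact (continuous_pi fun i => continuous_apply _).continuousOn
  · intros; rfl
  · intro x hx h0
    obtain ⟨v, hv, hxv⟩ := hcon x hx
    exact hxv (by simpa using congrFun h0 (T.equivFin ⟨v, hv⟩))

namespace SimpleGraph

variable {V : Type*} [Fintype V] (G : SimpleGraph V) [DecidableRel G.Adj]

/-! ### The Rayleigh quotient -/

lemma degreeNorm_nonneg (x : V → ℝ) : 0 ≤ G.degreeNorm x :=
  Finset.sum_nonneg fun _ _ => by positivity

variable {G} in
lemma degreeNorm_pos (hG : ∀ v, 0 < G.degree v) {x : V → ℝ} (hx : x ≠ 0) :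
    0 < G.degreeNorm x := by
  obtain ⟨v, hv⟩ := Function.ne_iff.mp hx
  refine Finset.sum_pos' (fun _ _ => by positivity) ⟨v, Finset.mem_univ v, ?_⟩
  have := hG v
  have : 0 < |x v| := abs_pos.mpr hv
  positivity

variable [DecidableEq V]

lemma degreeNorm_eq_sum_edges (x : V → ℝ) :
    G.degreeNorm x = ∑ e ∈ G.edgeFinset,
      Sym2.lift ⟨fun i j => |x i| + |x j|, fun i j => by simp only [add_comm]⟩ e := by
  have h1 : ∀ e ∈ G.edgeFinset,
      Sym2.lift ⟨fun i j => |x i| + |x j|, fun i j => by simp only [add_comm]⟩ e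
        = ∑ v, if v ∈ e then |x v| else 0 := by
    intro e he
    induction e with
    | h i j =>
      have hij : i ≠ j := G.ne_of_adj (by simpa using he)
      rw [← Finset.sum_filter, Sym2.lift_mk]
      have : (Finset.univ.filter fun v => v ∈ s(i, j)) = {i, j} := by ext; simp
      rw [this, Finset.sum_pair hij]
  rw [Finset.sum_congr rfl h1, Finset.sum_comm, degreeNorm]
  refine Finset.sum_congr rfl fun v _ => ?_
  rw [← Finset.sum_filter, Finset.sum_const, nsmul_eq_mul, ← G.card_incidenceFinset_eq_degree,
    G.incidenceFinset_eq_filter]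

lemma signlessVariation_nonneg (x : V → ℝ) : 0 ≤ G.signlessVariation x := by
  refine Finset.sum_nonneg fun e _ => ?_
  induction e with
  | h i j => exact abs_nonneg _

lemma signlessVariation_le (x : V → ℝ) : G.signlessVariation x ≤ G.degreeNorm x := by
  rw [degreeNorm_eq_sum_edges]
  refine Finset.sum_le_sum fun e _ => ?_
  induction e with
  | h i j => exact abs_add_le _ _

variable {G} in
/-- An edge on which `x` takes opposite nonzero values makes the triangle inequality strict. -/
lemma signlessVariation_lt {x : V → ℝ} {u v : V} (huv : G.Adj u v) (h : x u + x v = 0)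
    (hu : x u ≠ 0) : G.signlessVariation x < G.degreeNorm x := by
  rw [degreeNorm_eq_sum_edges]
  refine Finset.sum_lt_sum (fun e _ => ?_) ⟨s(u, v), by simpa using huv, ?_⟩
  · induction e with
    | h i j => exact abs_add_le _ _
  · have : 0 < |x u| := abs_pos.mpr hu
    simp only [Sym2.lift_mk, h, abs_zero]
    positivity

variable {G} in
lemma signlessVariation_eq_of_support_indep {x : V → ℝ} {I : Finset V} (hI : G.IsIndepSet I)
    (hx : ∀ v ∉ I, x v = 0) : G.signlessVariation x = G.degreeNorm x := by
  rw [degreeNorm_eq_sum_edges]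
  refine Finset.sum_congr rfl fun e he => ?_
  induction e with
  | h i j =>
    have hadj : G.Adj i j := by simpa using he
    have : x i = 0 ∨ x j = 0 := by
      by_contra! hcon
      have hi : i ∈ I := by_contra fun h => hcon.1 (hx i h)
      have hj : j ∈ I := by_contra fun h => hcon.2 (hx j h)
      exact hI hi hj hadj.ne hadj
    rcases this with h | h <;> simp [h]

lemma signlessRayleigh_nonneg (x : V → ℝ) : 0 ≤ G.signlessRayleigh x :=
  div_nonneg (G.signlessVariation_nonneg x) (G.degreeNorm_nonneg x)

lemma signlessRayleigh_le_one (x : V → ℝ) : G.signlessRayleigh x ≤ 1 :=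
  div_le_one_of_le₀ (G.signlessVariation_le x) (G.degreeNorm_nonneg x)

variable {G} in
lemma continuousOn_signlessRayleigh (hG : ∀ v, 0 < G.degree v) :
    ContinuousOn G.signlessRayleigh {x | x ≠ 0} := by
  refine ContinuousOn.div ?_ ?_ fun x hx => (degreeNorm_pos hG hx).ne'
  · refine (continuous_finsetSum _ fun e _ => ?_).continuousOn
    induction e with
    | h i j =>
      simp only [Sym2.lift_mk]
      fun_prop
  · unfold degreeNorm
    fun_prop

/-! ### Eigenvalues equal to one and below one -/

variable {G}

lemma signlessEigenvalue_eq_one (hG : ∀ v, 0 < G.degree v) {k : ℕ} {I : Finset V}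
    (hI : G.IsIndepSet I) (hk : k ≤ Fintype.card V) (hkI : Fintype.card V < k + I.card) :
    G.signlessEigenvalue k = 1 := by
  unfold signlessEigenvalue
  rw [← csInf_singleton (1 : ℝ)]
  congr 1
  refine (Set.Nonempty.subset_singleton_iff ?_).mp ?_
  · obtain ⟨S, hS, hsymm, h0, -, hgenus⟩ :=
      exists_compact_symmetric_subset_of_submodule (⊤ : Submodule ℝ (V → ℝ))
    refine ⟨_, S, hS, hsymm, h0, le_trans ?_ hgenus, rfl⟩
    simpa using hk
  · rintro _ ⟨S, hS, hsymm, h0, hgenus, rfl⟩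
    have hcard : (Iᶜ.card : ℕ∞) < k := by
      have := Finset.card_le_univ I
      rw [Finset.card_compl]
      exact_mod_cast (by omega : Fintype.card V - I.card < k)
    obtain ⟨x, hxS, hx⟩ := exists_forall_eq_zero_of_card_lt_genus Iᶜ (hcard.trans_le hgenus)
    have hx0 : x ≠ 0 := fun h => h0 (h ▸ hxS)
    have hx1 : G.signlessRayleigh x = 1 := by
      rw [signlessRayleigh,
        signlessVariation_eq_of_support_indep hI (fun v hv => hx v (by simpa using hv)),
        div_self (degreeNorm_pos hG hx0).ne']
    refine IsGreatest.csSup_eq ⟨⟨x, hxS, hx1⟩, ?_⟩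
    rintro _ ⟨y, -, rfl⟩
    exact G.signlessRayleigh_le_one y

/-- If `F` is an edge cover, then the space of all `x` with `x u + x v = 0` for `uv ∈ F` has
dimension at least `|V| - |F|`, and every nonzero `x` in it has Rayleigh quotient below `1`. -/
lemma signlessEigenvalue_lt_one (hG : ∀ v, 0 < G.degree v) {k : ℕ} (hk1 : 1 ≤ k)
    {F : Finset (Sym2 V)} (hF : G.IsEdgeCover F) (hk : k + F.card ≤ Fintype.card V) :
    G.signlessEigenvalue k < 1 := by
  let A : (V → ℝ) →ₗ[ℝ] (F → ℝ) := LinearMap.pi fun e : F =>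
    LinearMap.proj (R := ℝ) (φ := fun _ : V => ℝ) (Quot.out e.1).1 +
      LinearMap.proj (R := ℝ) (φ := fun _ : V => ℝ) (Quot.out e.1).2
  have hA : ∀ x ∈ LinearMap.ker A, ∀ u v, s(u, v) ∈ F → x u + x v = 0 := by
    intro x hx u v huv
    have h1 : x (Quot.out s(u, v)).1 + x (Quot.out s(u, v)).2 = 0 :=
      congrFun (LinearMap.mem_ker.mp hx) ⟨s(u, v), huv⟩
    have h2 : s((Quot.out s(u, v)).1, (Quot.out s(u, v)).2) = s(u, v) := Quot.out_eq s(u, v)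
    rcases Sym2.eq_iff.mp h2 with ⟨h, h'⟩ | ⟨h, h'⟩
    · rwa [h, h'] at h1
    · rwa [h, h', add_comm] at h1
  have hdim : k ≤ Module.finrank ℝ (LinearMap.ker A) := by
    have h1 := A.finrank_range_add_finrank_ker
    have h2 := (LinearMap.range A).finrank_le
    simp only [Module.finrank_fintype_fun_eq_card, Fintype.card_coe] at h1 h2
    omega
  obtain ⟨S, hS, hsymm, h0, hSA, hgenus⟩ :=
    exists_compact_symmetric_subset_of_submodule (LinearMap.ker A)
  have hkS : (k : ℕ∞) ≤ krasnoselskiiGenus S := le_trans (by exact_mod_cast hdim) hgenus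
  obtain ⟨x₀, hx₀, -⟩ := exists_forall_eq_zero_of_card_lt_genus (S := S) ∅
    (lt_of_lt_of_le (by exact_mod_cast hk1) hkS)
  have hlt : ∀ x ∈ S, G.signlessRayleigh x < 1 := by
    intro x hx
    have hx0 : x ≠ 0 := fun h => h0 (h ▸ hx)
    obtain ⟨u, hu⟩ := Function.ne_iff.mp hx0
    obtain ⟨e, he, hue⟩ := hF.2 u
    obtain ⟨v, rfl⟩ := Sym2.mem_iff_exists.mp hue
    rw [signlessRayleigh, div_lt_one (degreeNorm_pos hG hx0)]
    exact signlessVariation_lt (hF.1 he) (hA x (hSA hx) u v he) hu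
  have hcont : ContinuousOn G.signlessRayleigh S :=
    (continuousOn_signlessRayleigh hG).mono fun x hx h => h0 (h ▸ hx)
  obtain ⟨y, hy, hymax⟩ := hS.exists_isMaxOn ⟨x₀, hx₀⟩ hcont
  refine lt_of_le_of_lt (csInf_le ⟨0, ?_⟩ ⟨S, hS, hsymm, h0, hkS, rfl⟩) ?_
  · rintro _ ⟨T, -, -, -, -, rfl⟩
    refine Real.sSup_nonneg ?_
    rintro _ ⟨z, -, rfl⟩
    exact G.signlessRayleigh_nonneg z
  · have : IsGreatest (G.signlessRayleigh '' S) (G.signlessRayleigh y) := by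
      refine ⟨⟨y, hy, rfl⟩, ?_⟩
      rintro _ ⟨z, hz, rfl⟩
      exact hymax hz
    rw [this.csSup_eq]
    exact hlt y hy

lemma indepNum_le_signlessMultiplicity_one (hG : ∀ v, 0 < G.degree v) :
    G.indepNum ≤ G.signlessMultiplicity 1 := by
  obtain ⟨I, hI, hcard⟩ := G.exists_isNIndepSet_indepNum
  have hle : I.card ≤ Fintype.card V := Finset.card_le_univ I
  have hsub : ((Finset.Ioc (Fintype.card V - I.card) (Fintype.card V) : Finset ℕ) : Set ℕ) ⊆
      {k : ℕ | 1 ≤ k ∧ k ≤ Fintype.card V ∧ G.signlessEigenvalue k = 1} := by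
    intro k hk
    simp only [Finset.coe_Ioc, Set.mem_Ioc] at hk
    exact ⟨by omega, hk.2, signlessEigenvalue_eq_one hG hI hk.2 (by omega)⟩
  have := Set.ncard_le_ncard hsub
    ((Set.finite_Icc 1 (Fintype.card V)).subset fun k hk => ⟨hk.1, hk.2.1⟩)
  rw [Set.ncard_coe_finset, Nat.card_Ioc] at this
  rw [signlessMultiplicity]
  omega

lemma signlessMultiplicity_one_le_card (hG : ∀ v, 0 < G.degree v) {F : Finset (Sym2 V)}
    (hF : G.IsEdgeCover F) : G.signlessMultiplicity 1 ≤ F.card := by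
  have hsub : {k : ℕ | 1 ≤ k ∧ k ≤ Fintype.card V ∧ G.signlessEigenvalue k = 1} ⊆
      (Finset.Ioc (Fintype.card V - F.card) (Fintype.card V) : Finset ℕ) := by
    rintro k ⟨hk1, hk, hk'⟩
    simp only [Finset.coe_Ioc, Set.mem_Ioc]
    refine ⟨?_, hk⟩
    by_contra hcon
    exact (signlessEigenvalue_lt_one hG hk1 hF (by omega)).ne hk'
  have := Set.ncard_le_ncard hsub (Finset.finite_toSet _)
  rw [Set.ncard_coe_finset, Nat.card_Ioc] at this
  rw [signlessMultiplicity]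
  omega

lemma signlessMultiplicity_one_le_edgeCoverNum (hG : ∀ v, 0 < G.degree v) :
    (G.signlessMultiplicity 1 : ℕ∞) ≤ G.edgeCoverNum := by
  classical
  refine le_iInf₂ fun F hF => ?_
  have := signlessMultiplicity_one_le_card (F := F.toFinset) hG (by simpa using hF)
  rw [← Set.coe_toFinset F, Set.encard_coe_eq_coe_finsetCard]
  exact_mod_cast this

/-! ### König's theorem for edge covers -/

/-- If `X` lies in one colour class and avoids a maximum independent set `I`, then exchanging the
neighbours of `X` in `I` for `X` gives an independent set, so `X` has at least `|X|` of them. -/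
lemma card_le_card_neighbors_of_indep (C : G.Coloring (Fin 2)) {I : Finset V}
    (hI : G.IsNIndepSet G.indepNum I) {X : Finset V} (hX : Disjoint X I) {c : Fin 2}
    (hXc : ∀ v ∈ X, C v = c) :
    X.card ≤ (X.biUnion fun v => I.filter (G.Adj v)).card := by
  set N := X.biUnion fun v => I.filter (G.Adj v) with hN
  have hNI : N ⊆ I := Finset.biUnion_subset.mpr fun v _ => Finset.filter_subset _ _
  have hmem : ∀ u ∈ X, ∀ v ∈ I, G.Adj u v → v ∈ N := fun u hu v hv huv =>
    Finset.mem_biUnion.mpr ⟨u, hu, Finset.mem_filter.mpr ⟨hv, huv⟩⟩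
  have hind : G.IsIndepSet (X ∪ I \ N : Finset V) := by
    intro u hu v hv huv hadj
    simp only [Finset.coe_union, Finset.coe_sdiff, Set.mem_union, Finset.mem_coe, Set.mem_sdiff]
      at hu hv
    rcases hu with hu | ⟨hu, hu'⟩ <;> rcases hv with hv | ⟨hv, hv'⟩
    · exact C.valid hadj ((hXc u hu).trans (hXc v hv).symm)
    · exact hv' (hmem u hu v hv hadj)
    · exact hu' (hmem v hv u hu hadj.symm)
    · exact hI.isIndepSet hu hv huv hadj
  have h1 := hind.card_le_indepNum
  rw [Finset.card_union_of_disjoint (hX.mono_right Finset.sdiff_subset),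
    Finset.card_sdiff_of_subset hNI, hI.card_eq] at h1
  have h2 := Finset.card_le_card hNI
  rw [hI.card_eq] at h2
  omega

/-- In a bipartite graph without isolated vertices, Hall's theorem matches the complement of a
maximum independent set into that set; one edge at each vertex of the set then suffices. -/
lemma IsBipartite.exists_isEdgeCover_card_le (hb : G.IsBipartite) (hG : ∀ v, 0 < G.degree v) :
    ∃ F : Finset (Sym2 V), G.IsEdgeCover F ∧ F.card ≤ G.indepNum := by
  obtain ⟨C⟩ := hb
  obtain ⟨I, hI⟩ := G.exists_isNIndepSet_indepNum
  obtain ⟨f, hinj, hf⟩ := (Finset.all_card_le_biUnion_card_iff_exists_injective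
    (fun v : {v // v ∉ I} => I.filter (G.Adj v))).mp (by
      intro s
      let X : Fin 2 → Finset V := fun c => (s.map (Function.Embedding.subtype _)).filter (C · = c)
      have hXI : ∀ c, Disjoint (X c) I := fun c => by
        rw [Finset.disjoint_left]
        intro v hv
        obtain ⟨⟨w, hw⟩, -, rfl⟩ := Finset.mem_map.mp (Finset.mem_filter.mp hv).1
        exact hw
      have hXc : ∀ c, ∀ v ∈ X c, C v = c := fun c v hv => (Finset.mem_filter.mp hv).2
      let N : Fin 2 → Finset V := fun c => (X c).biUnion fun v => I.filter (G.Adj v)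
      -- neighbours of the two colour classes have different colours
      have hNdisj : Disjoint (N 0) (N 1) := by
        rw [Finset.disjoint_left]
        intro v h0 h1
        obtain ⟨a, ha, hav⟩ := Finset.mem_biUnion.mp h0
        obtain ⟨b, hb, hbv⟩ := Finset.mem_biUnion.mp h1
        have h0' := C.valid (Finset.mem_filter.mp hav).2
        have h1' := C.valid (Finset.mem_filter.mp hbv).2
        rw [hXc 0 a ha] at h0'
        rw [hXc 1 b hb] at h1'
        omega
      have hNsub : ∀ c, N c ⊆ s.biUnion fun v => I.filter (G.Adj v) := fun c w hw => by
        obtain ⟨a, ha, haw⟩ := Finset.mem_biUnion.mp hw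
        obtain ⟨a, ha', rfl⟩ := Finset.mem_map.mp (Finset.mem_filter.mp ha).1
        exact Finset.mem_biUnion.mpr ⟨a, ha', haw⟩
      have hs : s.card = (X 0).card + (X 1).card := by
        rw [← Finset.card_map (Function.Embedding.subtype _),
          Finset.card_eq_sum_card_fiberwise (f := C) (t := Finset.univ) (by simp),
          Fin.sum_univ_two]
      calc s.card = (X 0).card + (X 1).card := hs
        _ ≤ (N 0).card + (N 1).card := add_le_add
          (card_le_card_neighbors_of_indep C hI (hXI 0) (hXc 0))
          (card_le_card_neighbors_of_indep C hI (hXI 1) (hXc 1))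
        _ = (N 0 ∪ N 1).card := (Finset.card_union_of_disjoint hNdisj).symm
        _ ≤ _ := Finset.card_le_card (Finset.union_subset (hNsub 0) (hNsub 1)))
  have hnbr : ∀ v, ∃ w, G.Adj v w := fun v => (G.degree_pos_iff_exists_adj v).mp (hG v)
  have hg : ∀ v, ∃ w, G.Adj v w ∧ ∀ u, f u = v → w = u := by
    intro v
    by_cases h : ∃ u, f u = v
    · obtain ⟨u, rfl⟩ := h
      exact ⟨u, (Finset.mem_filter.mp (hf u)).2.symm, fun w hw => by rw [hinj hw]⟩
    · obtain ⟨w, hw⟩ := hnbr v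
      exact ⟨w, hw, fun u hu => absurd ⟨u, hu⟩ h⟩
  choose g hg hgf using hg
  refine ⟨I.image fun v => s(v, g v), ⟨?_, ?_⟩, Finset.card_image_le.trans_eq hI.card_eq⟩
  · intro e he
    obtain ⟨v, -, rfl⟩ := Finset.mem_image.mp (Finset.mem_coe.mp he)
    exact hg v
  · intro v
    by_cases hv : v ∈ I
    · exact ⟨s(v, g v), Finset.mem_coe.mpr (Finset.mem_image_of_mem _ hv), by simp⟩
    · have hfI : f ⟨v, hv⟩ ∈ I := (Finset.mem_filter.mp (hf ⟨v, hv⟩)).1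
      refine ⟨s(f ⟨v, hv⟩, g (f ⟨v, hv⟩)),
        Finset.mem_coe.mpr (Finset.mem_image_of_mem _ hfI), ?_⟩
      rw [hgf (f ⟨v, hv⟩) ⟨v, hv⟩ rfl]
      simp

end SimpleGraph

theorem mainTheorem1 {V : Type*} [Fintype V] [DecidableEq V] (G : SimpleGraph V)
    [DecidableRel G.Adj] (hG : ∀ v : V, 0 < G.degree v) :
    (G.indepNum ≤ G.signlessMultiplicity 1 ∧
      (G.signlessMultiplicity 1 : ℕ∞) ≤ G.edgeCoverNum) ∧
    (G.Connected → G.IsBipartite → G.signlessMultiplicity 1 = G.indepNum) := by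
  have hlow := SimpleGraph.indepNum_le_signlessMultiplicity_one hG
  refine ⟨⟨hlow, SimpleGraph.signlessMultiplicity_one_le_edgeCoverNum hG⟩, fun _ hb => ?_⟩
  obtain ⟨F, hF, hcard⟩ := hb.exists_isEdgeCover_card_le hG
  exact le_antisymm ((SimpleGraph.signlessMultiplicity_one_le_card hG hF).trans hcard) hlow
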